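/- **Conventions.** All relations are finitary Boolean relations, and all (total or partial) functions are Boolean functions of positive arity. For a set $\mathrm{C}$ of functions, $\mathrm{IC}$ is the set of all relations preserved by every function in $\mathrm{C}$; for a set $\Gamma$ of relations, $\mathrm{pPol}(\Gamma)$ is the set of all partial functions preserving every relation of $\Gamma$. $\langle\Gamma\rangle$ (resp. $\langle\Gamma\rangle_{\not\exists}$) is the set of relations definable by primitive positive (resp. quantifier-free primitive positive) formulas over $\Gamma\cup\{=\}$, where the always false atomic formula is also admitted. A finite set $\Gamma$ is a *weak base* of $\mathrm{IC}$ if $\mathrm{pPol}(\Gamma)=\bigcup_{D}\mathrm{pPol}(D)$, the union being over all sets of relations $D$ with $D=\langle D\rangle_{\not\exists}$ and $\langle D\rangle=\mathrm{IC}$. A relation $R$ is *irredundant* if no two of its arguments are equal on all tuples of $R$, and *minimal* if it is irredundant and there is no $R'\subsetneq R$ with $\langle \{R'\}\rangle=\langle \{R\}\rangle$. A *minimal weak base* is a minimal relation $R$ such that $\{R\}$ is a weak base. $\mathrm{COLS}^s$ is the $2^s$-ary relation with $s$ tuples whose columns are the binary expansions of $0,\dots,2^s-1$, and $\mathrm{C}(R)$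 is the intersection of all relations of $\mathrm{IC}$ (of the same arity as $R$) that contain $R$. Let $\mathrm{R}_0$ and $\mathrm{R}_1$ be the sets of functions with $f(0,\dots,0)=0$ and with $f(1,\dots,1)=1$, respectively; $\mathrm{M}$ the monotone functions; $\mathrm{D}$ the self-dual functions; $\mathrm{V}$ the functions $c\vee\bigvee_{i\in S}x_i$ and $\mathrm{E}$ the functions $c\wedge\bigwedge_{i\in S}x_i$ ($c\in\{0,1\}$, $S$ a possibly empty set of arguments). Put $\mathrm{M}_0=\mathrm{M}\cap\mathrm{R}_0$, $\mathrm{M}_1=\mathrm{M}\cap\mathrm{R}_1$, $\mathrm{M}_2=\mathrm{M}\cap\mathrm{R}_0\cap\mathrm{R}_1$, $\mathrm{D}_2=\mathrm{D}\cap\mathrm{M}$, $\mathrm{V}_1=\mathrm{V}\cap\mathrm{R}_1$, $\mathrm{V}_2=\mathrm{V}\cap\mathrm{R}_0\cap\mathrm{R}_1$, $\mathrm{E}_0=\mathrm{E}\cap\mathrm{R}_0$, $\mathrm{E}_2=\mathrm{E}\cap\mathrm{R}_0\cap\mathrm{R}_1$. Write $\mathrm{F}=\{(0)\}$ and $\mathrm{T}=\{(1)\}$.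 **Lemma.** For each row of the following table, $R_{\mathrm{IC}}$ is a minimal weak base of $\mathrm{IC}$. Moreover, $R_{\mathrm{IC}}$ is obtained from $\mathrm{C}(\mathrm{COLS}^s)$, for the listed $s$, by a finite sequence of the following operations: identifying two arguments; passing to the irredundant core (keeping only the first of each class of arguments that are equal on all tuples); permuting the arguments. | $\mathrm{IC}$ | $s$ | $R_{\mathrm{IC}}$ | |---|---|---| | $\mathrm{IM}_0$ | 2 | $(x_1\to x_2)\wedge \mathrm{F}(c_0)$ | | $\mathrm{IM}_1$ | 2 | $(x_1\to x_2)\wedge \mathrm{T}(c_1)$ | | $\mathrm{IM}_2$ | 3 | $(x_1\to x_2)\wedge \mathrm{F}(c_0)\wedge \mathrm{T}(c_1)$ | | $\mathrm{ID}_2$ | 3 | $(x_1\vee x_2)\wedge(x_1\neq x_3)\wedge(x_2\neq x_4)\wedge \mathrm{F}(c_0)\wedge \mathrm{T}(c_1)$ | | $\mathrm{IV}_1$ | 3 | $(\overline{x_1}\leftrightarrow\overline{x_2}\,\overline{x_3})\wedge(\overline{x_2}\vee\overline{x_3}\to\overline{x_4})\wedge \mathrm{T}(c_1)$ | | $\mathrm{IV}_2$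 | 3 | $(\overline{x_1}\leftrightarrow\overline{x_2}\,\overline{x_3})\wedge \mathrm{F}(c_0)\wedge \mathrm{T}(c_1)$ | | $\mathrm{IE}_0$ | 3 | $(x_1\leftrightarrow x_2x_3)\wedge(x_2\vee x_3\to x_4)\wedge \mathrm{F}(c_0)$ | | $\mathrm{IE}_2$ | 3 | $(x_1\leftrightarrow x_2x_3)\wedge \mathrm{F}(c_0)\wedge \mathrm{T}(c_1)$ | The arguments of each relation are ordered $x_1,x_2,\dots$, then $c_0$ (if present), then $c_1$ (if present). -/

import Mathlib

namespace WeakBases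

/-! ## Boolean relations and functions -/

/-- A Boolean relation: an arity together with a set of tuples. -/
structure BRel where
  arity : ℕ
  tuples : Set (Fin arity → Bool)

/-- A total Boolean function of positive arity. -/
structure BFun where
  arity : ℕ
  pos : 0 < arity
  toFun : (Fin arity → Bool) → Bool

/-- A partial Boolean function of positive arity; the value `none` means "undefined". -/
structure PartialBFun where
  arity : ℕ
  pos : 0 < arity
  toFun : (Fin arity → Bool) → Option Bool

/-- `f` preserves `R`: applying `f` coordinatewise to tuples of `R` gives a tuple of `R`. -/
def BFun.Preserves (f : BFun) (R : BRel) : Prop :=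
  ∀ T : Fin f.arity → (Fin R.arity → Bool), (∀ i, T i ∈ R.tuples) →
    (fun j => f.toFun (fun i => T i j)) ∈ R.tuples

/-- The partial function `f` preserves `R`: whenever `f` is defined on every coordinate of a
sequence of tuples of `R`, the resulting tuple `u` belongs to `R`. -/
def PartialBFun.Preserves (f : PartialBFun) (R : BRel) : Prop :=
  ∀ (T : Fin f.arity → (Fin R.arity → Bool)) (u : Fin R.arity → Bool),
    (∀ i, T i ∈ R.tuples) → (∀ j, f.toFun (fun i => T i j) = some (u j)) → u ∈ R.tuples

/-- The set of all relations preserved by all functions in `F`. -/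
def Inv (F : Set BFun) : Set BRel := {R | ∀ f ∈ F, f.Preserves R}

/-- The set of partial polymorphisms of `Γ`. -/
def pPol (Γ : Set BRel) : Set PartialBFun := {f | ∀ R ∈ Γ, f.Preserves R}

/-! ## Primitive positive definability -/

/-- The binary equality relation. -/
def eqRel : BRel := ⟨2, {t | t 0 = t 1}⟩

/-- The always false atomic formula, as a nullary relation. -/
def botRel : BRel := ⟨0, ∅⟩

/-- An atomic formula: a relation applied to a vector of variables from `V`. -/
structure BAtom (V : Type) where
  rel : BRel
  vars : Fin rel.arity → V

/-- The assignment `v` satisfies the atomic formula `a`. -/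
def BAtom.Holds {V : Type} (a : BAtom V) (v : V → Bool) : Prop :=
  (fun i => v (a.vars i)) ∈ a.rel.tuples

/-- `R(x) ≡ ∃ y, R₁(𝐱₁) ∧ ⋯ ∧ R_k(𝐱_k)` with every `R_i` in `Γ ∪ {=}`. As usual the always false
atom is admitted too; without it the empty relation, which every function preserves, would
not always be definable and the Galois connection with `Inv` and `Pol` would fail. -/
def PPDefinable (Γ : Set BRel) (R : BRel) : Prop :=
  ∃ (m : ℕ) (φ : List (BAtom (Fin R.arity ⊕ Fin m))),
    (∀ a ∈ φ, a.rel ∈ Γ ∪ {eqRel, botRel}) ∧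
    ∀ x : Fin R.arity → Bool,
      x ∈ R.tuples ↔ ∃ y : Fin m → Bool, ∀ a ∈ φ, a.Holds (Sum.elim x y)

/-- Quantifier-free primitive positive definability. -/
def QPPDefinable (Γ : Set BRel) (R : BRel) : Prop :=
  ∃ φ : List (BAtom (Fin R.arity)),
    (∀ a ∈ φ, a.rel ∈ Γ ∪ {eqRel, botRel}) ∧
    ∀ x : Fin R.arity → Bool, x ∈ R.tuples ↔ ∀ a ∈ φ, a.Holds x

/-- The co-clone `⟨Γ⟩` generated by `Γ`. -/
def coClone (Γ : Set BRel) : Set BRel := {R | PPDefinable Γ R}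

/-- The closure `⟨Γ⟩_∄` of `Γ` under quantifier-free primitive positive definitions. -/
def weakPartialCoClone (Γ : Set BRel) : Set BRel := {R | QPPDefinable Γ R}

/-! ## Minimal weak bases -/

/-- The weak partial co-clones `D` (sets with `D = ⟨D⟩_∄`) such that `⟨D⟩ = Inv C`. -/
def coCloneInterval (C : Set BFun) : Set (Set BRel) :=
  {D | D = weakPartialCoClone D ∧ coClone D = Inv C}

/-- The union of all strong partial clones covering `C`. -/
def unionCover (C : Set BFun) : Set PartialBFun := ⋃ D ∈ coCloneInterval C, pPol D

/-- The (finite) constraint language `Γ` is a weak base of `Inv C`. -/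
def IsWeakBase (C : Set BFun) (Γ : Set BRel) : Prop :=
  Γ.Finite ∧ pPol Γ = unionCover C

/-- No two arguments (columns of the matrix whose rows are the tuples) of `R` coincide. -/
def BRel.Irredundant (R : BRel) : Prop :=
  ∀ i j : Fin R.arity, i ≠ j → ∃ t ∈ R.tuples, t i ≠ t j

/-- `R` is irredundant and no proper subrelation of `R` generates the same co-clone. -/
def BRel.IsMinimal (R : BRel) : Prop :=
  R.Irredundant ∧
    ¬ ∃ S : Set (Fin R.arity → Bool), S ⊂ R.tuples ∧ coClone {R} = coClone {⟨R.arity, S⟩}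

/-- The relation `R` is a minimal weak base of `Inv C`. -/
def IsMinimalWeakBase (C : Set BFun) (R : BRel) : Prop :=
  IsWeakBase C {R} ∧ R.IsMinimal

/-! ## The relations `C(COLS^s)` and the rules on relations -/

/-- The `2^s`-ary relation with `s` tuples whose columns are the binary expansions of the numbers
`0, …, 2^s - 1`. -/
def COLS (s : ℕ) : BRel :=
  ⟨2 ^ s, {t | ∃ i < s, t = fun j => Nat.testBit j.val i}⟩

/-- `C(R)`: the intersection of all relations in `Inv C` that contain `R`. -/
def extension (C : Set BFun) (R : BRel) : BRel :=
  ⟨R.arity, ⋂ S ∈ {S : Set (Fin R.arity → Bool) | (⟨R.arity, S⟩ : BRel) ∈ Inv C ∧ R.tuples ⊆ S}, S⟩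

/-- One step of rewriting a relation by identifying two arguments, permuting the arguments, or
passing to the irredundant core. -/
inductive Rule : BRel → BRel → Prop
  /-- Identify argument `i` with argument `j`, where `i < j`; argument `j` disappears. -/
  | identify {n : ℕ} (S : Set (Fin (n + 1) → Bool)) (i j : Fin (n + 1)) (hij : i < j) :
      Rule ⟨n + 1, S⟩
        ⟨n, {x | Fin.insertNth (α := fun _ => Bool) j (x ⟨i.val, by omega⟩) x ∈ S}⟩
  /-- `R'(x₁, …, x_n) ≡ R(x_{π(1)}, …, x_{π(n)})`. -/
  | permute {n : ℕ} (S : Set (Fin n → Bool)) (π : Equiv.Perm (Fin n)) :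
      Rule ⟨n, S⟩ ⟨n, {x | (fun k => x (π k)) ∈ S}⟩
  /-- Of each class of equal arguments keep only the first one; `e` lists the kept ones. -/
  | irr {m n : ℕ} (S : Set (Fin n → Bool)) (e : Fin m ↪o Fin n)
      (hcover : ∀ j : Fin n, ∃ k : Fin m, e k ≤ j ∧ ∀ t ∈ S, t j = t (e k))
      (hirr : BRel.Irredundant ⟨m, (fun t k => t (e k)) '' S⟩) :
      Rule ⟨n, S⟩ ⟨m, (fun t k => t (e k)) '' S⟩

/-- `R'` is obtained from `R` by a finite sequence of rules. -/
def Derives (R R' : BRel) : Prop := Relation.ReflTransGen Rule R R'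

/-! ## The clones -/

/-- The functions with `f(0, …, 0) = 0`. -/
def clR0 : Set BFun := {f | f.toFun (fun _ => false) = false}

/-- The functions with `f(1, …, 1) = 1`. -/
def clR1 : Set BFun := {f | f.toFun (fun _ => true) = true}

/-- The monotone functions. -/
def clM : Set BFun := {f | Monotone f.toFun}

/-- The self-dual functions. -/
def clD : Set BFun := {f | ∀ x, f.toFun (fun i => !(x i)) = !(f.toFun x)}

/-- The functions `c ∨ ⋁_{i ∈ S} x_i`, that is, the disjunctions and the constants. -/
def clV : Set BFun :=
  {f | ∃ (c : Bool) (S : Finset (Fin f.arity)), ∀ x, f.toFun x = c ⊔ S.sup x}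

/-- The functions `c ∧ ⋀_{i ∈ S} x_i`, that is, the conjunctions and the constants. -/
def clE : Set BFun :=
  {f | ∃ (c : Bool) (S : Finset (Fin f.arity)), ∀ x, f.toFun x = c ⊓ S.inf x}

def clM0 : Set BFun := clM ∩ clR0
def clM1 : Set BFun := clM ∩ clR1
def clM2 : Set BFun := clM ∩ clR0 ∩ clR1
def clD2 : Set BFun := clD ∩ clM
def clV1 : Set BFun := clV ∩ clR1
def clV2 : Set BFun := clV ∩ clR0 ∩ clR1
def clE0 : Set BFun := clE ∩ clR0
def clE2 : Set BFun := clE ∩ clR0 ∩ clR1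

/-! ## The tabulated relations

The arguments are ordered `x₁, x₂, …` first, then `c₀` (if present), then `c₁` (if present). -/

/-- `(x₁ → x₂) ∧ F(c₀)` -/
def relIM0 : BRel := ⟨3, {t | (t 0 → t 1) ∧ t 2 = false}⟩

/-- `(x₁ → x₂) ∧ T(c₁)` -/
def relIM1 : BRel := ⟨3, {t | (t 0 → t 1) ∧ t 2 = true}⟩

/-- `(x₁ → x₂) ∧ F(c₀) ∧ T(c₁)` -/
def relIM2 : BRel := ⟨4, {t | (t 0 → t 1) ∧ t 2 = false ∧ t 3 = true}⟩

/-- `(x₁ ∨ x₂) ∧ (x₁ ≠ x₃) ∧ (x₂ ≠ x₄) ∧ F(c₀) ∧ T(c₁)` -/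
def relID2 : BRel :=
  ⟨6, {t | (t 0 ∨ t 1) ∧ t 0 ≠ t 2 ∧ t 1 ≠ t 3 ∧ t 4 = false ∧ t 5 = true}⟩

/-- `(¬x₁ ↔ ¬x₂¬x₃) ∧ (¬x₂ ∨ ¬x₃ → ¬x₄) ∧ T(c₁)` -/
def relIV1 : BRel :=
  ⟨5, {t | (¬ t 0 ↔ (¬ t 1 ∧ ¬ t 2)) ∧ ((¬ t 1 ∨ ¬ t 2) → ¬ t 3) ∧ t 4 = true}⟩

/-- `(¬x₁ ↔ ¬x₂¬x₃) ∧ F(c₀) ∧ T(c₁)` -/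
def relIV2 : BRel :=
  ⟨5, {t | (¬ t 0 ↔ (¬ t 1 ∧ ¬ t 2)) ∧ t 3 = false ∧ t 4 = true}⟩

/-- `(x₁ ↔ x₂x₃) ∧ (x₂ ∨ x₃ → x₄) ∧ F(c₀)` -/
def relIE0 : BRel :=
  ⟨5, {t | (t 0 ↔ (t 1 ∧ t 2)) ∧ ((t 1 ∨ t 2) → t 3) ∧ t 4 = false}⟩

/-- `(x₁ ↔ x₂x₃) ∧ F(c₀) ∧ T(c₁)` -/
def relIE2 : BRel :=
  ⟨5, {t | (t 0 ↔ (t 1 ∧ t 2)) ∧ t 3 = false ∧ t 4 = true}⟩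

end WeakBases

open WeakBases

/-! Read a tuple indexed by the columns of `COLS s` as the table of an `s`-ary function. Its rows
are the tables of the projections, so for a clone C the relation C(COLS^s) consists of the tables of
the `s`-ary members of C. Each tabulated relation R arises from it by merging columns along a
surjection γ (`tableRel`). Weak base: if D generates Inv C, then Pol D = C, so a table outside C
violates some P in D on some tuples. Naming the columns of those tuples through γ turns P into an
atom that holds on R and fails there. Hence R lies in every weak partial co-clone D generating Inv C
(`tableRel_mem`); as soon as Pol R = C, R is a weak base. Minimality: suppose S ⊊ R has the same
polymorphisms, and let F ∉ C be ternary. It suffices that, for any three tuples of R, either F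
agrees on them with a member of C or members of C produce all of R from them: F would then preserve
S (`isMinimal_of_ternary`). Each row thus reduces to a choice of γ and F, finite checks, and a proof
that Pol R ⊆ C. -/

namespace WeakBases

/-! ## Polymorphisms and definability -/

/-- The functions preserving every relation of `Γ`. -/
def Pol (Γ : Set BRel) : Set BFun := {f | ∀ R ∈ Γ, f.Preserves R}

/-- The atoms over `Γ`, equality and falsity with variables in `V`. -/
def atomsOver (Γ : Set BRel) (V : Type) : Set (BAtom V) := {a | a.rel ∈ Γ ∪ {eqRel, botRel}}

/-- Over finitely many variables, a conjunction of atoms is equivalent to a finite one. -/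
theorem exists_list_of_atoms {V : Type} [Finite V] (A : Set (BAtom V)) :
    ∃ φ : List (BAtom V), (∀ a ∈ φ, a ∈ A) ∧
      ∀ v : V → Bool, (∀ a ∈ φ, a.Holds v) ↔ ∀ a ∈ A, a.Holds v := by
  classical
  have := Fintype.ofFinite V
  -- Only finitely many assignments violate `A`; one violated atom for each suffices.
  have hex : ∀ v : {v : V → Bool // ¬ ∀ a ∈ A, a.Holds v}, ∃ a ∈ A, ¬ a.Holds v.1 := by
    rintro ⟨v, hv⟩
    push Not at hv
    exact hv
  choose w hwA hw using hex
  refine ⟨(Finset.univ.toList).map w, ?_, fun v => ⟨fun h => ?_, fun h a ha => ?_⟩⟩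
  · intro a ha
    obtain ⟨v, -, rfl⟩ := List.mem_map.1 ha
    exact hwA v
  · by_contra hv
    exact hw ⟨v, hv⟩ (h _ (List.mem_map.2 ⟨⟨v, hv⟩, by simp, rfl⟩))
  · obtain ⟨u, -, rfl⟩ := List.mem_map.1 ha
    exact h _ (hwA u)

/-- A relation is quantifier-free definable as soon as each tuple outside of it violates an atom
that holds on the whole relation. -/
theorem qppDefinable_of_separates {Γ : Set BRel} {R : BRel}
    (h : ∀ x, x ∉ R.tuples →
      ∃ a ∈ atomsOver Γ (Fin R.arity), (∀ y ∈ R.tuples, a.Holds y) ∧ ¬ a.Holds x) :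
    QPPDefinable Γ R := by
  obtain ⟨φ, hφ, hv⟩ :=
    exists_list_of_atoms {a ∈ atomsOver Γ (Fin R.arity) | ∀ y ∈ R.tuples, a.Holds y}
  refine ⟨φ, fun a ha => (hφ a ha).1, fun x => ?_⟩
  rw [hv]
  refine ⟨fun hx a ha => ha.2 x hx, fun hx => ?_⟩
  by_contra hxR
  obtain ⟨a, ha, hay, hax⟩ := h x hxR
  exact hax (hx a ⟨ha, hay⟩)

theorem QPPDefinable.separates {Γ : Set BRel} {R : BRel} (h : QPPDefinable Γ R)
    {x : Fin R.arity → Bool} (hx : x ∉ R.tuples) :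
    ∃ a ∈ atomsOver Γ (Fin R.arity), (∀ y ∈ R.tuples, a.Holds y) ∧ ¬ a.Holds x := by
  obtain ⟨φ, hφ, hR⟩ := h
  have : ¬ ∀ a ∈ φ, a.Holds x := fun h => hx ((hR x).2 h)
  push Not at this
  obtain ⟨a, ha, hax⟩ := this
  exact ⟨a, hφ a ha, fun y hy => (hR y).1 hy a ha, hax⟩

theorem subset_weakPartialCoClone (Γ : Set BRel) : Γ ⊆ weakPartialCoClone Γ := fun R hR =>
  qppDefinable_of_separates fun _ hx => ⟨⟨R, id⟩, Or.inl hR, fun _ hy => hy, hx⟩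

/-- Substituting variables into a separating atom for the inner relation gives one for the outer
relation. -/
theorem weakPartialCoClone_idem (Γ : Set BRel) :
    weakPartialCoClone (weakPartialCoClone Γ) = weakPartialCoClone Γ := by
  refine Set.Subset.antisymm (fun R hR => qppDefinable_of_separates fun x hx => ?_)
    (subset_weakPartialCoClone _)
  obtain ⟨a, ha, hay, hax⟩ := hR.separates hx
  rcases ha with ha | ha
  · obtain ⟨b, hb, hby, hbx⟩ := QPPDefinable.separates ha hax
    exact ⟨⟨b.rel, fun i => a.vars (b.vars i)⟩, hb, fun y hy => hby _ (hay y hy), hbx⟩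
  · exact ⟨a, Or.inr ha, hay, hax⟩

theorem weakPartialCoClone_subset_coClone (Γ : Set BRel) :
    weakPartialCoClone Γ ⊆ coClone Γ := by
  rintro R ⟨φ, hφ, hR⟩
  refine ⟨0, φ.map fun a => ⟨a.rel, fun i => Sum.inl (a.vars i)⟩, ?_, fun x => ?_⟩
  · intro a ha
    obtain ⟨b, hb, rfl⟩ := List.mem_map.1 ha
    exact hφ b hb
  · rw [hR]
    simp [BAtom.Holds]

theorem subset_coClone (Γ : Set BRel) : Γ ⊆ coClone Γ :=
  (subset_weakPartialCoClone Γ).trans (weakPartialCoClone_subset_coClone Γ)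

theorem BFun.preserves_of_mem_atomsOver {Γ : Set BRel} {f : BFun} (hf : f ∈ Pol Γ) {V : Type}
    {a : BAtom V} (ha : a ∈ atomsOver Γ V) : f.Preserves a.rel := by
  rcases ha with ha | ha | ha
  · exact hf _ ha
  · rw [ha]
    intro T hT
    exact congrArg f.toFun (funext hT)
  · rw [Set.mem_singleton_iff.1 ha]
    -- Positive arity supplies an argument, hence an impossible tuple of the empty relation.
    exact fun T hT => hT ⟨0, f.pos⟩

theorem PartialBFun.preserves_of_mem_atomsOver {Γ : Set BRel} {f : PartialBFun} (hf : f ∈ pPol Γ)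
    {V : Type} {a : BAtom V} (ha : a ∈ atomsOver Γ V) : f.Preserves a.rel := by
  rcases ha with ha | ha | ha
  · exact hf _ ha
  · rw [ha]
    intro T u hT hu
    have : f.toFun (fun i => T i (0 : Fin 2)) = f.toFun (fun i => T i (1 : Fin 2)) :=
      congrArg f.toFun (funext hT)
    exact Option.some.inj ((hu (0 : Fin 2)).symm.trans (this.trans (hu (1 : Fin 2))))
  · rw [Set.mem_singleton_iff.1 ha]
    exact fun T u hT _ => hT ⟨0, f.pos⟩

/-- Without quantifiers every variable of an atom is an argument of the relation, so `f` is defined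
on all columns the atom uses. -/
theorem pPol_weakPartialCoClone (Γ : Set BRel) : pPol (weakPartialCoClone Γ) = pPol Γ := by
  refine Set.Subset.antisymm (fun f hf R hR => hf R (subset_weakPartialCoClone Γ hR)) ?_
  rintro f hf R ⟨φ, hφ, hR⟩ T u hT hu
  refine (hR u).2 fun a ha => ?_
  exact PartialBFun.preserves_of_mem_atomsOver hf (hφ a ha) _ _
    (fun i => (hR _).1 (hT i) a ha) (fun j => hu (a.vars j))

theorem Pol_coClone (Γ : Set BRel) : Pol (coClone Γ) = Pol Γ := by
  refine Set.Subset.antisymm (fun f hf R hR => hf R (subset_coClone Γ hR)) ?_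
  rintro f hf R ⟨m, φ, hφ, hR⟩ T hT
  choose y hy using fun i => (hR _).1 (hT i)
  refine (hR _).2 ⟨fun j => f.toFun fun i => y i j, fun a ha => ?_⟩
  have := BFun.preserves_of_mem_atomsOver hf (hφ a ha) _ fun i => hy i a ha
  refine (congrArg (· ∈ a.rel.tuples) (funext fun j => ?_)).mp this
  rcases a.vars j with k | k <;> rfl

/-- The Galois connection: relations preserved by all polymorphisms of `Γ` are primitive positive
definable over `Γ`. -/
theorem coClone_eq_Inv_Pol (Γ : Set BRel) : coClone Γ = Inv (Pol Γ) := by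
  classical
  refine Set.Subset.antisymm (fun R hR f hf => ?_) fun R hR => ?_
  · rw [← Pol_coClone] at hf
    exact hf R hR
  obtain ⟨k, ⟨rows⟩⟩ := Finite.exists_equiv_fin R.tuples
  -- One bound variable per possible column of a `k`-row matrix: a solution `y` is the table of a
  -- `k`-ary function.
  let col := Fintype.equivFin (Fin k → Bool)
  let v : Fin k → (Fin R.arity ⊕ Fin (Fintype.card (Fin k → Bool)) → Bool) :=
    fun i => Sum.elim (rows.symm i).1 fun j => col.symm j i
  obtain ⟨φ, hφ, hφv⟩ := exists_list_of_atoms {a ∈ atomsOver Γ _ | ∀ i, a.Holds (v i)}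
  refine ⟨_, φ, fun a ha => (hφ a ha).1, fun x => ⟨fun hx => ?_, ?_⟩⟩
  · refine ⟨fun j => col.symm j (rows ⟨x, hx⟩), fun a ha => ?_⟩
    simpa [v] using (hφ a ha).2 (rows ⟨x, hx⟩)
  · rintro ⟨y, hy⟩
    rw [hφv] at hy
    have hk : 0 < k := by
      -- For empty `R` the false atom is vacuously among those holding on all rows.
      by_contra hk
      obtain rfl : k = 0 := by omega
      exact hy ⟨botRel, Fin.elim0⟩ ⟨Or.inr (Or.inr rfl), fun i => i.elim0⟩
    have hf : (⟨k, hk, fun z => y (col z)⟩ : BFun) ∈ Pol Γ := by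
      intro P hP T hT
      refine hy ⟨P, fun j => Sum.inr (col fun i => T i j)⟩ ⟨Or.inl hP, fun i => ?_⟩
      simpa [BAtom.Holds, v] using hT i
    -- Equality atoms tie each free variable to the bound variable of its own column.
    have hx : x = fun j => y (col fun i => (rows.symm i).1 j) := by
      funext j
      refine hy ⟨eqRel, ![Sum.inl j, Sum.inr (col fun i => (rows.symm i).1 j)]⟩
        ⟨Or.inr (Or.inl rfl), fun i => ?_⟩
      change (rows.symm i).1 j = col.symm (col fun i => (rows.symm i).1 j) i
      rw [col.symm_apply_apply]
    rw [hx]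
    exact hR _ hf (fun i => (rows.symm i).1) fun i => (rows.symm i).2

/-! ## Clones and tables of functions -/

/-- A set of functions containing the projections and closed under composition. -/
structure IsClone (C : Set BFun) : Prop where
  proj : ∀ {s : ℕ} (hs : 0 < s) (i : Fin s), (⟨s, hs, fun z => z i⟩ : BFun) ∈ C
  comp : ∀ f ∈ C, ∀ {s : ℕ} (hs : 0 < s) (g : Fin f.arity → (Fin s → Bool) → Bool),
    (∀ i, (⟨s, hs, g i⟩ : BFun) ∈ C) →
      (⟨s, hs, fun z => f.toFun fun i => g i z⟩ : BFun) ∈ C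

theorem IsClone.inter {C D : Set BFun} (hC : IsClone C) (hD : IsClone D) : IsClone (C ∩ D) where
  proj hs i := ⟨hC.proj hs i, hD.proj hs i⟩
  comp f hf _ hs g hg :=
    ⟨hC.comp f hf.1 hs g fun i => (hg i).1, hD.comp f hf.2 hs g fun i => (hg i).2⟩

/-- The relation with arguments `Fin n` obtained from the tables of the `s`-ary functions of `C`
by merging arguments along `γ`. -/
def tableRel (C : Set BFun) {s : ℕ} (hs : 0 < s) {n : ℕ} (γ : (Fin s → Bool) → Fin n) : BRel :=
  ⟨n, {x | (⟨s, hs, fun z => x (γ z)⟩ : BFun) ∈ C}⟩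

theorem IsClone.tableRel_mem_Inv {C : Set BFun} (hC : IsClone C) {s : ℕ} (hs : 0 < s) {n : ℕ}
    (γ : (Fin s → Bool) → Fin n) : tableRel C hs γ ∈ Inv C := fun f hf T hT =>
  hC.comp f hf hs (fun i z => T i (γ z)) hT

theorem IsClone.Pol_Inv {C : Set BFun} (hC : IsClone C) : Pol (Inv C) = C := by
  refine Set.Subset.antisymm ?_ fun f hf R hR => hR f hf
  rintro ⟨s, hs, F⟩ hf
  let e := Fintype.equivFin (Fin s → Bool)
  -- Applying the function to the tables of the projections returns its own table, which must
  -- therefore lie in the invariant relation.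
  have := hf _ (hC.tableRel_mem_Inv hs e) (fun i j => e.symm j i) fun i => by
    change (⟨s, hs, fun z => e.symm (e z) i⟩ : BFun) ∈ C
    simpa using hC.proj hs i
  change (⟨s, hs, fun z => F (e.symm (e z))⟩ : BFun) ∈ C at this
  simpa using this

/-- The column of `COLS s` with index `j`: the binary digits of `j`. -/
def columnBits (s : ℕ) (j : Fin (2 ^ s)) : Fin s → Bool := fun i => j.val.testBit i

theorem columnBits_surjective (s : ℕ) : Function.Surjective (columnBits s) := fun z =>
  ⟨⟨Nat.ofBits z, Nat.ofBits_lt_two_pow z⟩, by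
    funext i
    simp [columnBits, Nat.testBit_ofBits_lt]⟩

theorem columnBits_injective (s : ℕ) : Function.Injective (columnBits s) := fun a b h => by
  refine Fin.ext (Nat.eq_of_testBit_eq fun i => ?_)
  by_cases hi : i < s
  · exact congrFun h ⟨i, hi⟩
  -- Both indices are below `2 ^ s`, so their bits from `s` on vanish.
  · have := Nat.pow_le_pow_right (n := 2) (by norm_num) (not_lt.1 hi)
    rw [Nat.testBit_lt_two_pow (a.2.trans_le this), Nat.testBit_lt_two_pow (b.2.trans_le this)]

theorem IsClone.mem_extension_COLS {C : Set BFun} (hC : IsClone C) {s : ℕ} (hs : 0 < s)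
    (F : (Fin s → Bool) → Bool) :
    (fun j => F (columnBits s j)) ∈ (extension C (COLS s)).tuples ↔ (⟨s, hs, F⟩ : BFun) ∈ C := by
  let e := Equiv.ofBijective _ ⟨columnBits_injective s, columnBits_surjective s⟩
  have he : ∀ z, columnBits s (e.symm z) = z := e.apply_symm_apply
  constructor
  · intro h
    have := Set.mem_iInter₂.1 h (tableRel C hs e.symm).tuples ⟨hC.tableRel_mem_Inv hs e.symm, ?_⟩
    · simpa [tableRel, he] using this
    · rintro t ⟨i, hi, rfl⟩
      have hp := hC.proj hs ⟨i, hi⟩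
      refine (congrArg (fun G => (⟨s, hs, G⟩ : BFun) ∈ C) (funext fun z => ?_)).mp hp
      exact (congrFun (he z) ⟨i, hi⟩).symm
  · intro h
    refine Set.mem_iInter₂.2 fun S hS => ?_
    exact hS.1 _ h (fun i j => j.val.testBit i) fun i => hS.2 ⟨i, i.2, rfl⟩

/-- Arguments may be merged and permuted along any surjection. -/
theorem derives_of_surjective {n m : ℕ} (S : Set (Fin n → Bool)) (g : Fin n → Fin m)
    (hg : Function.Surjective g) : Derives ⟨n, S⟩ ⟨m, {x | (fun k => x (g k)) ∈ S}⟩ := by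
  induction n with
  | zero =>
    obtain rfl : m = 0 := by
      rcases m with _ | m
      · rfl
      · exact (hg 0).choose.elim0
    refine Relation.ReflTransGen.single ?_
    have := Rule.permute S (Equiv.refl _)
    convert this using 6
  | succ n ih =>
    by_cases hinj : Function.Injective g
    · obtain rfl : n + 1 = m := by
        exact Fin.equiv_iff_eq.1 ⟨Equiv.ofBijective g ⟨hinj, hg⟩⟩
      exact Relation.ReflTransGen.single (Rule.permute S (Equiv.ofBijective g ⟨hinj, hg⟩))
    · obtain ⟨i, j, hij, hlt⟩ : ∃ i j, g i = g j ∧ i < j := by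
        simp only [Function.Injective] at hinj
        push Not at hinj
        obtain ⟨a, b, hab, hne⟩ := hinj
        rcases lt_or_gt_of_ne hne with h | h
        · exact ⟨a, b, hab, h⟩
        · exact ⟨b, a, hab.symm, h⟩
      -- Since `i < j`, deleting position `j` leaves index `i` unchanged.
      have hi : j.succAbove ⟨i.val, by omega⟩ = i := by
        rw [Fin.succAbove_of_castSucc_lt _ _ hlt]
        rfl
      refine Relation.ReflTransGen.head (Rule.identify S i j hlt) ?_
      have := ih {x | Fin.insertNth (α := fun _ => Bool) j (x ⟨i.val, by omega⟩) x ∈ S}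
        (fun k => g (j.succAbove k)) fun b => ?_
      · refine (congrArg (fun S' => Derives _ ⟨m, S'⟩) (Set.ext fun x => ?_)).mp this
        refine iff_of_eq (congrArg (· ∈ S) ?_)
        rw [Fin.insertNth_eq_iff]
        refine ⟨?_, rfl⟩
        simp only [hi, hij]
      · obtain ⟨a, rfl⟩ := hg b
        -- If the preimage was the deleted `j`, its twin `i` replaces it.
        by_cases haj : a = j
        · exact ⟨⟨i.val, by omega⟩, by simp only [hi]; rw [haj, hij]⟩
        · obtain ⟨k, rfl⟩ := Fin.exists_succAbove_eq haj
          exact ⟨k, rfl⟩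

theorem IsClone.derives_tableRel {C : Set BFun} (hC : IsClone C) {s : ℕ} (hs : 0 < s) {n : ℕ}
    {γ : (Fin s → Bool) → Fin n} (hγ : Function.Surjective γ) :
    Derives (extension C (COLS s)) (tableRel C hs γ) := by
  have := derives_of_surjective (extension C (COLS s)).tuples (fun j => γ (columnBits s j))
    (hγ.comp (columnBits_surjective s))
  refine (congrArg (Derives _) ?_).mp this
  unfold tableRel
  congr 1
  ext x
  exact hC.mem_extension_COLS hs fun z => x (γ z)

/-- Every weak partial co-clone generating `Inv C` contains the merged table relations. -/
theorem IsClone.tableRel_mem {C : Set BFun} (hC : IsClone C) {s : ℕ} (hs : 0 < s) {n : ℕ}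
    (γ : (Fin s → Bool) → Fin n) {D : Set BRel} (hD : D ∈ coCloneInterval C) :
    tableRel C hs γ ∈ D := by
  have hPol : Pol D = C := by rw [← Pol_coClone, hD.2, hC.Pol_Inv]
  rw [hD.1]
  refine qppDefinable_of_separates fun x hx => ?_
  have hx' : (⟨s, hs, fun z => x (γ z)⟩ : BFun) ∉ Pol D := by rwa [hPol]
  simp only [Pol, Set.mem_ofPred_eq, BFun.Preserves] at hx'
  push Not at hx'
  obtain ⟨P, hP, T, hT, hxT⟩ := hx'
  -- Each column of the violating tuples names, through `γ`, a variable of the separating atom.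
  refine ⟨⟨P, fun j => γ fun i => T i j⟩, Or.inl hP, fun y hy => ?_, hxT⟩
  have hy' : (⟨s, hs, fun z => y (γ z)⟩ : BFun) ∈ Pol D := by rwa [hPol]
  exact hy' P hP T hT

/-- The closure of the relation is one member of the interval, and every member contains the
relation; so its `pPol` is the largest set in the union. -/
theorem IsClone.isWeakBase_tableRel {C : Set BFun} (hC : IsClone C) {s : ℕ} (hs : 0 < s) {n : ℕ}
    (γ : (Fin s → Bool) → Fin n) (h : ∀ f : BFun, f.Preserves (tableRel C hs γ) → f ∈ C) :
    IsWeakBase C {tableRel C hs γ} := by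
  have hPol : Pol {tableRel C hs γ} = C :=
    Set.Subset.antisymm (fun f hf => h f (hf _ rfl)) fun f hf R hR => by
      rw [Set.mem_singleton_iff.1 hR]
      exact hC.tableRel_mem_Inv hs γ f hf
  refine ⟨Set.finite_singleton _, Set.Subset.antisymm ?_ ?_⟩
  · rw [← pPol_weakPartialCoClone]
    refine Set.subset_biUnion_of_mem (u := pPol) ⟨(weakPartialCoClone_idem _).symm, ?_⟩
    rw [coClone_eq_Inv_Pol]
    refine congrArg Inv (Set.Subset.antisymm (fun f hf => ?_) fun f hf => ?_)
    · rw [← hPol]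
      exact fun R hR => hf R (subset_weakPartialCoClone _ hR)
    rw [← hPol] at hf
    rw [← Pol_coClone] at hf
    exact fun R hR => hf R (weakPartialCoClone_subset_coClone _ hR)
  · refine Set.iUnion₂_subset fun D hD f hf R hR => ?_
    rw [Set.mem_singleton_iff.1 hR]
    exact hf _ (hC.tableRel_mem hs γ hD)

/-! ## Minimality -/

/-- A ternary function. -/
def ternary (F : Bool → Bool → Bool → Bool) : BFun := ⟨3, by norm_num, fun z => F (z 0) (z 1) (z 2)⟩

theorem ternary_preserves {F : Bool → Bool → Bool → Bool} {R : BRel} :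
    (ternary F).Preserves R ↔
      ∀ a ∈ R.tuples, ∀ b ∈ R.tuples, ∀ c ∈ R.tuples, (fun j => F (a j) (b j) (c j)) ∈ R.tuples :=
  ⟨fun h a ha b hb c hc => h ![a, b, c] fun i => by
      change Fin 3 at i
      fin_cases i <;> assumption,
    fun h T hT => h _ (hT _) _ (hT _) _ (hT _)⟩

/-- `R` is minimal if some ternary `F` outside of its clone maps any three tuples of `R` into
their closure, unless that closure is all of `R`. -/
theorem isMinimal_of_ternary {C : Set BFun} {R : BRel} (hR : ∀ f : BFun, f ∈ C ↔ f.Preserves R)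
    (hirr : R.Irredundant) (F : Bool → Bool → Bool → Bool) (hF : ternary F ∉ C)
    (L : List (Bool → Bool → Bool → Bool)) (hL : ∀ G ∈ L, ternary G ∈ C)
    (h : ∀ a ∈ R.tuples, ∀ b ∈ R.tuples, ∀ c ∈ R.tuples,
      (∃ G ∈ L, ∀ j, F (a j) (b j) (c j) = G (a j) (b j) (c j)) ∨
        ∀ r ∈ R.tuples, ∃ G ∈ L, ∀ j, r j = G (a j) (b j) (c j)) :
    R.IsMinimal := by
  refine ⟨hirr, ?_⟩
  rintro ⟨S, hS, heq⟩
  have hPol : Pol {R} = Pol {⟨R.arity, S⟩} := by rw [← Pol_coClone, heq, Pol_coClone]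
  have hC : ∀ f : BFun, f ∈ C ↔ f.Preserves ⟨R.arity, S⟩ := fun f => by
    rw [hR]
    simpa [Pol] using Set.ext_iff.1 hPol f
  rw [hC, ternary_preserves] at hF
  refine hF fun a ha b hb c hc => ?_
  rcases h a (hS.1 ha) b (hS.1 hb) c (hS.1 hc) with ⟨G, hG, hFG⟩ | hcov
  · rw [funext hFG]
    exact ternary_preserves.1 ((hC _).1 (hL G hG)) a ha b hb c hc
  · refine absurd (fun r hr => ?_) hS.2
    obtain ⟨G, hG, hrG⟩ := hcov r hr
    rw [funext hrG]
    exact ternary_preserves.1 ((hC _).1 (hL G hG)) a ha b hb c hc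

theorem IsClone.isMinimalWeakBase_and_derives {C : Set BFun} (hC : IsClone C) {s : ℕ} (hs : 0 < s)
    {n : ℕ} {p : (Fin n → Bool) → Prop} (γ : (Fin s → Bool) → Fin n)
    (hγ : Function.Surjective γ) (hpγ : ∀ x, (⟨s, hs, fun z => x (γ z)⟩ : BFun) ∈ C ↔ p x)
    (hPol : ∀ f : BFun, (∀ T : Fin f.arity → Fin n → Bool, (∀ i, p (T i)) →
      p fun j => f.toFun fun i => T i j) → f ∈ C)
    (hirr : ∀ i j : Fin n, i ≠ j → ∃ t, p t ∧ t i ≠ t j)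
    (F : Bool → Bool → Bool → Bool) (hF : ternary F ∉ C)
    (L : List (Bool → Bool → Bool → Bool)) (hL : ∀ G ∈ L, ternary G ∈ C)
    (h : ∀ a, p a → ∀ b, p b → ∀ c, p c →
      (∃ G ∈ L, ∀ j, F (a j) (b j) (c j) = G (a j) (b j) (c j)) ∨
        ∀ r, p r → ∃ G ∈ L, ∀ j, r j = G (a j) (b j) (c j)) :
    IsMinimalWeakBase C ⟨n, {x | p x}⟩ ∧ Derives (extension C (COLS s)) ⟨n, {x | p x}⟩ := by
  have hR : tableRel C hs γ = ⟨n, {x | p x}⟩ := congrArg (BRel.mk n) (Set.ext hpγ)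
  replace hPol : ∀ f : BFun, f.Preserves ⟨n, {x | p x}⟩ → f ∈ C := hPol
  rw [← hR] at hPol ⊢
  refine ⟨⟨hC.isWeakBase_tableRel hs γ hPol, isMinimal_of_ternary
    (fun f => ⟨hC.tableRel_mem_Inv hs γ f, hPol f⟩) (fun i j hij => ?_) F hF L hL ?_⟩,
    hC.derives_tableRel hs hγ⟩
  · obtain ⟨t, ht, hne⟩ := hirr i j hij
    exact ⟨t, (hpγ t).2 ht, hne⟩
  · rw [hR]
    exact h

/-! ## The clones of the table -/

/-- Both sides express that `x` and `y` are true at a common index; swapping them gives equality. -/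
theorem sup_filter_le {ι : Type*} [Fintype ι] (x y : ι → Bool) :
    (Finset.univ.filter fun i => x i = true).sup y ≤
      (Finset.univ.filter fun i => y i = true).sup x := by
  refine Finset.sup_le fun i hi => ?_
  have hx : x i = true := by simpa using hi
  cases hy : y i
  · exact bot_le
  · exact hx.ge.trans (Finset.le_sup (f := x) (by simpa using hy))

theorem le_inf_filter {ι : Type*} [Fintype ι] (x y : ι → Bool) :
    (Finset.univ.filter fun i => y i = false).inf x ≤
      (Finset.univ.filter fun i => x i = false).inf y := by
  refine Finset.le_inf fun i hi => ?_
  have hx : x i = false := by simpa using hi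
  cases hy : y i
  · exact (Finset.inf_le (f := x) (by simpa using hy)).trans hx.le
  · exact le_top

/-- The functions in `V` are those preserving binary joins. -/
theorem mem_clV_iff (f : BFun) :
    f ∈ clV ↔ ∀ x y, f.toFun (fun i => x i || y i) = (f.toFun x || f.toFun y) := by
  constructor
  · rintro ⟨c, S, h⟩ x y
    have : S.sup (fun i => x i || y i) = S.sup x ⊔ S.sup y := Finset.sup_sup
    rw [h, h, h, this]
    exact sup_sup_distrib_left _ _ _
  · intro h
    -- Build the indicator of `A` from singletons; the value at zero covers `A = ∅` and becomes the
    -- constant `c`.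
    have key : ∀ A : Finset (Fin f.arity), f.toFun (fun i => decide (i ∈ A)) =
        f.toFun (fun _ => false) ⊔ A.sup fun a => f.toFun fun i => decide (i = a) := by
      intro A
      induction A using Finset.induction_on with
      | empty => simp
      | insert a A _ ih =>
        have h1 := h (fun i => decide (i = a)) fun i => decide (i ∈ A)
        simp only [← Bool.decide_or, ← Finset.mem_insert] at h1
        rw [h1, ih, Finset.sup_insert]
        exact sup_left_comm _ _ _
    refine ⟨f.toFun fun _ => false,
      Finset.univ.filter fun a => f.toFun (fun i => decide (i = a)) = true, fun x => ?_⟩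
    have := key (Finset.univ.filter fun i => x i = true)
    simp only [Finset.mem_filter, Finset.mem_univ, true_and, Bool.decide_eq_true] at this
    rw [this]
    congr 1
    exact le_antisymm (sup_filter_le _ _) (sup_filter_le _ _)

/-- The functions in `E` are those preserving binary meets. -/
theorem mem_clE_iff (f : BFun) :
    f ∈ clE ↔ ∀ x y, f.toFun (fun i => x i && y i) = (f.toFun x && f.toFun y) := by
  constructor
  · rintro ⟨c, S, h⟩ x y
    have : S.inf (fun i => x i && y i) = S.inf x ⊓ S.inf y := Finset.inf_inf
    rw [h, h, h, this]
    exact inf_inf_distrib_left _ _ _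
  · intro h
    have key : ∀ A : Finset (Fin f.arity), f.toFun (fun i => decide (i ∉ A)) =
        f.toFun (fun _ => true) ⊓ A.inf fun a => f.toFun fun i => decide (i ≠ a) := by
      intro A
      induction A using Finset.induction_on with
      | empty => simp
      | insert a A _ ih =>
        have h1 := h (fun i => decide (i ≠ a)) fun i => decide (i ∉ A)
        simp only [← Bool.decide_and, ne_eq, ← not_or, ← Finset.mem_insert] at h1
        rw [h1, ih, Finset.inf_insert]
        exact inf_left_comm _ _ _
    refine ⟨f.toFun fun _ => true,
      Finset.univ.filter fun a => f.toFun (fun i => decide (i ≠ a)) = false, fun x => ?_⟩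
    have := key (Finset.univ.filter fun i => x i = false)
    simp only [Finset.mem_filter, Finset.mem_univ, true_and, Bool.not_eq_false,
      Bool.decide_eq_true] at this
    rw [this]
    congr 1
    exact le_antisymm (le_inf_filter _ _) (le_inf_filter _ _)

theorem isClone_clR0 : IsClone clR0 where
  proj _ _ := rfl
  comp f hf _ _ _ hg := (congrArg f.toFun (funext fun i => hg i)).trans hf

theorem isClone_clR1 : IsClone clR1 where
  proj _ _ := rfl
  comp f hf _ _ _ hg := (congrArg f.toFun (funext fun i => hg i)).trans hf

theorem isClone_clM : IsClone clM where
  proj _ i := fun _ _ h => h i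
  comp _ hf _ _ _ hg := fun _ _ h => hf fun i => hg i h

theorem isClone_clD : IsClone clD where
  proj _ _ _ := rfl
  comp f hf _ _ g hg z := by
    rw [← hf]
    exact congrArg f.toFun (funext fun i => hg i z)

theorem isClone_clV : IsClone clV where
  proj _ _ := (mem_clV_iff _).2 fun _ _ => rfl
  comp f hf _ _ g hg := by
    simp only [mem_clV_iff] at *
    intro x y
    simp only [← hf, hg]

theorem isClone_clE : IsClone clE where
  proj _ _ := (mem_clE_iff _).2 fun _ _ => rfl
  comp f hf _ _ g hg := by
    simp only [mem_clE_iff] at *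
    intro x y
    simp only [← hf, hg]

/-- Replacing the pair `x ≤ y` by `x`, `x ∨ y` makes the condition readable from tuples of the
tabulated relations. -/
theorem mem_clM_iff (f : BFun) :
    f ∈ clM ↔ ∀ x y : Fin f.arity → Bool,
      f.toFun x = true → f.toFun (fun i => x i || y i) = true := by
  constructor
  · intro h x y hx
    have : f.toFun x ≤ f.toFun fun i => x i || y i :=
      h fun i => (le_sup_left : x i ≤ x i ⊔ y i)
    exact this hx
  · intro h x y hxy hx
    have hy : (fun i => x i || y i) = y := funext fun i => sup_eq_right.2 (hxy i)
    exact hy ▸ h x y hx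

theorem isClone_clM0 : IsClone clM0 := isClone_clM.inter isClone_clR0
theorem isClone_clM1 : IsClone clM1 := isClone_clM.inter isClone_clR1
theorem isClone_clM2 : IsClone clM2 := isClone_clM0.inter isClone_clR1
theorem isClone_clD2 : IsClone clD2 := isClone_clD.inter isClone_clM
theorem isClone_clV1 : IsClone clV1 := isClone_clV.inter isClone_clR1
theorem isClone_clV2 : IsClone clV2 := (isClone_clV.inter isClone_clR0).inter isClone_clR1
theorem isClone_clE0 : IsClone clE0 := isClone_clE.inter isClone_clR0
theorem isClone_clE2 : IsClone clE2 := (isClone_clE.inter isClone_clR0).inter isClone_clR1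

theorem mem_clM0_iff (f : BFun) : f ∈ clM0 ↔
    (∀ x y : Fin f.arity → Bool, f.toFun x = true → f.toFun (fun i => x i || y i) = true) ∧
      f.toFun (fun _ => false) = false := and_congr (mem_clM_iff f) Iff.rfl

theorem mem_clM1_iff (f : BFun) : f ∈ clM1 ↔
    (∀ x y : Fin f.arity → Bool, f.toFun x = true → f.toFun (fun i => x i || y i) = true) ∧
      f.toFun (fun _ => true) = true := and_congr (mem_clM_iff f) Iff.rfl

theorem mem_clM2_iff (f : BFun) : f ∈ clM2 ↔
    ((∀ x y : Fin f.arity → Bool, f.toFun x = true → f.toFun (fun i => x i || y i) = true) ∧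
      f.toFun (fun _ => false) = false) ∧ f.toFun (fun _ => true) = true :=
  and_congr (mem_clM0_iff f) Iff.rfl

theorem mem_clD2_iff (f : BFun) : f ∈ clD2 ↔
    (∀ x : Fin f.arity → Bool, f.toFun (fun i => !(x i)) = !(f.toFun x)) ∧
      ∀ x y : Fin f.arity → Bool, f.toFun x = true → f.toFun (fun i => x i || y i) = true :=
  and_congr Iff.rfl (mem_clM_iff f)

theorem mem_clV1_iff (f : BFun) : f ∈ clV1 ↔
    (∀ x y, f.toFun (fun i => x i || y i) = (f.toFun x || f.toFun y)) ∧
      f.toFun (fun _ => true) = true := and_congr (mem_clV_iff f) Iff.rfl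

theorem mem_clV2_iff (f : BFun) : f ∈ clV2 ↔
    ((∀ x y, f.toFun (fun i => x i || y i) = (f.toFun x || f.toFun y)) ∧
      f.toFun (fun _ => false) = false) ∧ f.toFun (fun _ => true) = true :=
  and_congr (and_congr (mem_clV_iff f) Iff.rfl) Iff.rfl

theorem mem_clE0_iff (f : BFun) : f ∈ clE0 ↔
    (∀ x y, f.toFun (fun i => x i && y i) = (f.toFun x && f.toFun y)) ∧
      f.toFun (fun _ => false) = false := and_congr (mem_clE_iff f) Iff.rfl

theorem mem_clE2_iff (f : BFun) : f ∈ clE2 ↔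
    ((∀ x y, f.toFun (fun i => x i && y i) = (f.toFun x && f.toFun y)) ∧
      f.toFun (fun _ => false) = false) ∧ f.toFun (fun _ => true) = true :=
  and_congr (and_congr (mem_clE_iff f) Iff.rfl) Iff.rfl

/-! ## The rows of the table -/

theorem isMinimalWeakBase_relIM0 :
    IsMinimalWeakBase clM0 relIM0 ∧ Derives (extension clM0 (COLS 2)) relIM0 := by
  refine isClone_clM0.isMinimalWeakBase_and_derives (by norm_num)
    (fun z => if z 1 then 1 else if z 0 then 0 else 2) (by decide +kernel) ?_
    (fun f hf => (mem_clM0_iff f).2 ?_) (by decide +kernel)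
    -- The tuples form a three-element chain. Only `a` top and `b` middle lead out of it, and then
    -- `a`, `b` and the zero tuple are everything.
    (fun a b _ => a && !b) ?_
    [fun _ _ _ => false, fun a _ _ => a, fun _ b _ => b] ?_ (by decide +kernel)
  · simp only [mem_clM0_iff]
    decide +kernel
  · have key := fun x y : Fin f.arity → Bool =>
      hf (fun i => ![x i, x i || y i, false]) fun i => by cases x i <;> cases y i <;> decide
    exact ⟨fun x y => (key x y).1, (key (fun _ => false) fun _ => false).2⟩
  · rw [mem_clM0_iff]
    unfold ternary
    decide +kernel
  · simp only [mem_clM0_iff, ternary]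
    decide +kernel

theorem isMinimalWeakBase_relIM1 :
    IsMinimalWeakBase clM1 relIM1 ∧ Derives (extension clM1 (COLS 2)) relIM1 := by
  refine isClone_clM1.isMinimalWeakBase_and_derives (by norm_num)
    (fun z => if z 0 && z 1 then 2 else if z 0 || z 1 then 1 else 0) (by decide +kernel) ?_
    (fun f hf => (mem_clM1_iff f).2 ?_) (by decide +kernel)
    (fun a b _ => a || !b) ?_
    [fun _ _ _ => true, fun a _ _ => a, fun _ b _ => b] ?_ (by decide +kernel)
  · simp only [mem_clM1_iff]
    decide +kernel
  · have key := fun x y : Fin f.arity → Bool =>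
      hf (fun i => ![x i, x i || y i, true]) fun i => by cases x i <;> cases y i <;> decide
    exact ⟨fun x y => (key x y).1, (key (fun _ => false) fun _ => false).2⟩
  · rw [mem_clM1_iff]
    unfold ternary
    decide +kernel
  · simp only [mem_clM1_iff, ternary]
    decide +kernel

theorem isMinimalWeakBase_relIM2 :
    IsMinimalWeakBase clM2 relIM2 ∧ Derives (extension clM2 (COLS 3)) relIM2 := by
  refine isClone_clM2.isMinimalWeakBase_and_derives (by norm_num)
    (fun z => if z 0 && z 1 && z 2 then 3 else if z 0 && z 1 || z 0 && z 2 || z 1 && z 2 then 1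
      else if z 0 || z 1 || z 2 then 0 else 2) (by decide +kernel) ?_
    (fun f hf => (mem_clM2_iff f).2 ?_) (by decide +kernel)
    -- On the three-element chain of tuples this returns one of its arguments unless all three are
    -- distinct.
    (fun a b c => a && (!b || c)) ?_
    [fun a _ _ => a, fun _ b _ => b, fun _ _ c => c] ?_ (by decide +kernel)
  · simp only [mem_clM2_iff]
    decide +kernel
  · have key := fun x y : Fin f.arity → Bool =>
      hf (fun i => ![x i, x i || y i, false, true]) fun i => by cases x i <;> cases y i <;> decide
    exact ⟨⟨fun x y => (key x y).1, (key (fun _ => false) fun _ => false).2.1⟩,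
      (key (fun _ => false) fun _ => false).2.2⟩
  · rw [mem_clM2_iff]
    unfold ternary
    decide +kernel
  · simp only [mem_clM2_iff, ternary]
    decide +kernel

set_option synthInstance.maxHeartbeats 200000 in
set_option synthInstance.maxSize 1000 in
theorem isMinimalWeakBase_relID2 :
    IsMinimalWeakBase clD2 relID2 ∧ Derives (extension clD2 (COLS 3)) relID2 := by
  refine isClone_clD2.isMinimalWeakBase_and_derives (by norm_num)
    -- Self-duality pairs 011 with 100 and 101 with 010; f(010) ≤ f(011) then reads `x₁ ∨ x₂`.
    (fun z => if z 0 == z 1 then (if z 0 then 5 else 4) else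
      if z 0 then (if z 2 then 1 else 2) else if z 2 then 0 else 3) (by decide +kernel) ?_
    (fun f hf => (mem_clD2_iff f).2 ?_) (by decide +kernel)
    -- The relation has three tuples: if two arguments agree, the third is returned; otherwise the
    -- projections already give everything.
    (fun a b c => xor a (xor b c)) ?_
    [fun a _ _ => a, fun _ b _ => b, fun _ _ c => c] ?_ (by decide +kernel)
  · simp only [mem_clD2_iff]
    decide +kernel
  · have key := fun x y : Fin f.arity → Bool =>
      hf (fun i => ![!(x i), x i || y i, x i, !(x i || y i), false, true])
        fun i => by cases x i <;> cases y i <;> decide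
    have dual : ∀ x : Fin f.arity → Bool, f.toFun (fun i => !(x i)) = !(f.toFun x) := fun x =>
      Bool.eq_not_iff.2 (key x x).2.1
    refine ⟨dual, fun x y hx => (key x y).1.resolve_left ?_⟩
    change ¬ f.toFun (fun i => !(x i)) = true
    simp [dual, hx]
  · rw [mem_clD2_iff]
    unfold ternary
    decide +kernel
  · simp only [mem_clD2_iff, ternary]
    decide +kernel

set_option synthInstance.maxHeartbeats 200000 in
set_option synthInstance.maxSize 1000 in
theorem isMinimalWeakBase_relIV1 :
    IsMinimalWeakBase clV1 relIV1 ∧ Derives (extension clV1 (COLS 3)) relIV1 := by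
  refine isClone_clV1.isMinimalWeakBase_and_derives (by norm_num)
    -- `x₁, x₂, x₃, x₄` are the values at 110, 100, 010, 000; merging all columns with `z 2` true
    -- fixes those values to 1.
    (fun z => if z 2 then 4 else if z 0 then (if z 1 then 0 else 1) else
      if z 1 then 2 else 3) (by decide +kernel) ?_
    (fun f hf => (mem_clV1_iff f).2 ?_) (by decide +kernel)
    -- For comparable `b`, `c` the meet is one of them. Otherwise it adds only `x₁` and `c₁`, which
    -- `a` already has unless it is the bottom tuple; then joins and the constant 1 give everything.
    (fun a b c => a || (b && c)) ?_
    [fun _ _ _ => true, fun a _ _ => a, fun _ b _ => b, fun _ _ c => c,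
      fun a b _ => a || b, fun a _ c => a || c, fun _ b c => b || c] ?_ (by decide +kernel)
  · simp only [mem_clV1_iff]
    decide +kernel
  · have key := fun x y : Fin f.arity → Bool =>
      hf (fun i => ![x i || y i, x i, y i, false, true])
        fun i => by cases x i <;> cases y i <;> decide
    refine ⟨fun x y => ?_, (key (fun _ => false) fun _ => false).2.2⟩
    have h : ¬ f.toFun (fun i => x i || y i) = true ↔ ¬ f.toFun x = true ∧ ¬ f.toFun y = true :=
      (key x y).1
    rw [Bool.eq_iff_iff, Bool.or_eq_true]
    tauto
  · rw [mem_clV1_iff]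
    unfold ternary
    decide +kernel
  · simp only [mem_clV1_iff, ternary]
    decide +kernel

theorem isMinimalWeakBase_relIV2 :
    IsMinimalWeakBase clV2 relIV2 ∧ Derives (extension clV2 (COLS 3)) relIV2 := by
  refine isClone_clV2.isMinimalWeakBase_and_derives (by norm_num)
    (fun z => if z 2 then 4 else if z 0 then (if z 1 then 0 else 1) else
      if z 1 then 2 else 3) (by decide +kernel) ?_
    (fun f hf => (mem_clV2_iff f).2 ?_) (by decide +kernel)
    (fun a b c => a || (b && c)) ?_
    [fun a _ _ => a, fun _ b _ => b, fun _ _ c => c,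
      fun a b _ => a || b, fun a _ c => a || c, fun _ b c => b || c] ?_ (by decide +kernel)
  · simp only [mem_clV2_iff]
    decide +kernel
  · have key := fun x y : Fin f.arity → Bool =>
      hf (fun i => ![x i || y i, x i, y i, false, true])
        fun i => by cases x i <;> cases y i <;> decide
    refine ⟨⟨fun x y => ?_, (key (fun _ => false) fun _ => false).2.1⟩,
      (key (fun _ => false) fun _ => false).2.2⟩
    have h : ¬ f.toFun (fun i => x i || y i) = true ↔ ¬ f.toFun x = true ∧ ¬ f.toFun y = true :=
      (key x y).1
    rw [Bool.eq_iff_iff, Bool.or_eq_true]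
    tauto
  · rw [mem_clV2_iff]
    unfold ternary
    decide +kernel
  · simp only [mem_clV2_iff, ternary]
    decide +kernel

set_option synthInstance.maxHeartbeats 200000 in
set_option synthInstance.maxSize 1000 in
theorem isMinimalWeakBase_relIE0 :
    IsMinimalWeakBase clE0 relIE0 ∧ Derives (extension clE0 (COLS 3)) relIE0 := by
  refine isClone_clE0.isMinimalWeakBase_and_derives (by norm_num)
    (fun z => if !(z 2) then 4 else if z 0 then (if z 1 then 3 else 1) else
      if z 1 then 2 else 0) (by decide +kernel) ?_
    (fun f hf => (mem_clE0_iff f).2 ?_) (by decide +kernel)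
    -- Dual to the choice for `clV1`.
    (fun a b c => a && (b || c)) ?_
    [fun _ _ _ => false, fun a _ _ => a, fun _ b _ => b, fun _ _ c => c,
      fun a b _ => a && b, fun a _ c => a && c, fun _ b c => b && c] ?_ (by decide +kernel)
  · simp only [mem_clE0_iff]
    decide +kernel
  · have key := fun x y : Fin f.arity → Bool =>
      hf (fun i => ![x i && y i, x i, y i, x i || y i, false])
        fun i => by cases x i <;> cases y i <;> decide
    refine ⟨fun x y => ?_, (key (fun _ => false) fun _ => false).2.2⟩
    rw [Bool.eq_iff_iff, Bool.and_eq_true]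
    exact (key x y).1
  · rw [mem_clE0_iff]
    unfold ternary
    decide +kernel
  · simp only [mem_clE0_iff, ternary]
    decide +kernel

theorem isMinimalWeakBase_relIE2 :
    IsMinimalWeakBase clE2 relIE2 ∧ Derives (extension clE2 (COLS 3)) relIE2 := by
  refine isClone_clE2.isMinimalWeakBase_and_derives (by norm_num)
    (fun z => if !(z 2) then 3 else if z 0 then (if z 1 then 4 else 1) else
      if z 1 then 2 else 0) (by decide +kernel) ?_
    (fun f hf => (mem_clE2_iff f).2 ?_) (by decide +kernel)
    (fun a b c => a && (b || c)) ?_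
    [fun a _ _ => a, fun _ b _ => b, fun _ _ c => c,
      fun a b _ => a && b, fun a _ c => a && c, fun _ b c => b && c] ?_ (by decide +kernel)
  · simp only [mem_clE2_iff]
    decide +kernel
  · have key := fun x y : Fin f.arity → Bool =>
      hf (fun i => ![x i && y i, x i, y i, false, true])
        fun i => by cases x i <;> cases y i <;> decide
    refine ⟨⟨fun x y => ?_, (key (fun _ => false) fun _ => false).2.1⟩,
      (key (fun _ => false) fun _ => false).2.2⟩
    rw [Bool.eq_iff_iff, Bool.and_eq_true]
    exact (key x y).1
  · rw [mem_clE2_iff]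
    unfold ternary
    decide +kernel
  · simp only [mem_clE2_iff, ternary]
    decide +kernel

end WeakBases

theorem mainTheorem3 :
    (IsMinimalWeakBase clM0 relIM0 ∧ Derives (extension clM0 (COLS 2)) relIM0) ∧
    (IsMinimalWeakBase clM1 relIM1 ∧ Derives (extension clM1 (COLS 2)) relIM1) ∧
    (IsMinimalWeakBase clM2 relIM2 ∧ Derives (extension clM2 (COLS 3)) relIM2) ∧
    (IsMinimalWeakBase clD2 relID2 ∧ Derives (extension clD2 (COLS 3)) relID2) ∧
    (IsMinimalWeakBase clV1 relIV1 ∧ Derives (extension clV1 (COLS 3)) relIV1) ∧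
    (IsMinimalWeakBase clV2 relIV2 ∧ Derives (extension clV2 (COLS 3)) relIV2) ∧
    (IsMinimalWeakBase clE0 relIE0 ∧ Derives (extension clE0 (COLS 3)) relIE0) ∧
    (IsMinimalWeakBase clE2 relIE2 ∧ Derives (extension clE2 (COLS 3)) relIE2) :=
  ⟨isMinimalWeakBase_relIM0,
    isMinimalWeakBase_relIM1,
    isMinimalWeakBase_relIM2,
    isMinimalWeakBase_relID2,
    isMinimalWeakBase_relIV1,
    isMinimalWeakBase_relIV2,
    isMinimalWeakBase_relIE0,
    isMinimalWeakBase_relIE2⟩
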